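/- **Setting.** Consider a single-server queue with $K$ customer classes under discriminatory processor sharing, in a random environment. The environment $Z$ is an irreducible continuous-time Markov chain on $\{1,\dots,D\}$ with generator $Q=(q_{d\ell})$ and invariant distribution $\pi=(\pi_1,\dots,\pi_D)$. While $Z=d$, customers arrive in a Poisson stream of rate $\lambda_d\ge 0$, an arriving customer is of class $k$ with probability $\alpha_{k,d}$ (where $\sum_k\alpha_{k,d}=1$), and the service capacity is $c_d\ge 0$, with $c_d>0$ for at least one $d$. Put $\lambda_{k,d}=\alpha_{k,d}\lambda_d$; for each $k$ some $\lambda_{k,d}$ is positive. Class-$k$ customers have exponential service requirements with mean $1/\mu_k$ and weight $g_k>0$: when the queue-length vector is $m=(m_1,\dots,m_K)\neq 0$ and $Z=d$, class-$k$ customers depart at rate $\frac{g_k m_k}{\sum_j g_j m_j}\,\mu_k c_d$. Let $$\rho_\infty=\sum_{k}\frac{\sum_d \pi_d\lambda_{k,d}}{\mu_k\sum_d \pi_d c_d}.$$ For real $N>1$, the $N$-th system has the arrival rates $\lambda^{(N)}_d=\frac{\lambda_d}{\rho_\infty}\left(1-\frac1N\right)$ in place of $\lambda_d$ (so its traffic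 intensity is $1-1/N$), all other parameters being unchanged. Let $(M^{(N)},Z)$ have the stationary distribution of the Markov chain of queue lengths and environment in the $N$-th system, and for $z\in[0,1]^K$ let $$P^{(N)}_d(z)=\mathbb E\Big[\prod_k z_k^{M^{(N)}_k}\,\mathbf 1_{\{Z=d\}}\Big].$$ Write $e^{-s/N}=(e^{-s_1/N},\dots,e^{-s_K/N})$. Below, $N\to\infty$ through all reals or, more generally, along any fixed sequence or filter tending to infinity. **Proposition.** 1. Let $s\in[0,\infty)^K$ be such that the limit $\hat P_d(s)=\lim_{N\to\infty}P^{(N)}_d(e^{-s/N})$ exists for every $d$, and put $\hat P(s)=\sum_d\hat P_d(s)$. Then $\hat P_d(s)=\pi_d\,\hat P(s)$ for every $d$. 2. Consequently the scaled queue-length vector is independent of the environment in heavy traffic: if the limit $\hat P_d(s)$ exists for every $d$ and every $s\in(0,\infty)^K$, and if $\hat M$ (with values in $[0,\infty)^K$ almost surely) and $\hat Z$ (with values in $\{1,\dots,D\}$) are random variables on a probability space with $\hat P_d(s)=\mathbb E\big[e^{-\sum_k s_k\hat M_k}\mathbf 1_{\{\hat Z=d\}}\big]$ for all such $d$ and $s$,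 then $\hat M$ and $\hat Z$ are independent and $\mathbb P(\hat Z=d)=\pi_d$ for every $d$. -/

import Mathlib

open Filter Topology MeasureTheory ProbabilityTheory

/-- The data of a single-server queue with `K` customer classes under discriminatory processor
sharing (DPS), in a random environment with `D` states. -/
structure ModulatedDPS (K D : ℕ) where
  /-- Generator matrix of the environment. -/
  Q : Matrix (Fin D) (Fin D) ℝ
  Q_offDiag_nonneg : ∀ i j, i ≠ j → 0 ≤ Q i j
  Q_row_sum : ∀ i, ∑ j, Q i j = 0
  /-- Irreducibility: every state reaches every other one along positive rates. -/
  Q_irreducible : ∀ i j, Relation.ReflTransGen (fun a b => a ≠ b ∧ 0 < Q a b) i j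
  /-- The invariant distribution of the environment. -/
  envDist : Fin D → ℝ
  envDist_nonneg : ∀ d, 0 ≤ envDist d
  envDist_sum : ∑ d, envDist d = 1
  envDist_invariant : Matrix.vecMul envDist Q = 0
  /-- Total (unscaled) arrival rate in each state of the environment. -/
  lam : Fin D → ℝ
  lam_nonneg : ∀ d, 0 ≤ lam d
  /-- `alpha k d`: probability that a customer arriving in state `d` is of class `k`. -/
  alpha : Fin K → Fin D → ℝ
  alpha_nonneg : ∀ k d, 0 ≤ alpha k d
  alpha_sum : ∀ d, ∑ k, alpha k d = 1
  /-- Each class has a positive arrival rate in at least one state. -/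
  exists_arrival_pos : ∀ k, ∃ d, 0 < alpha k d * lam d
  /-- Service requirements of class `k` are exponential with mean `1 / mu k`. -/
  mu : Fin K → ℝ
  mu_pos : ∀ k, 0 < mu k
  /-- Service capacity in each state of the environment. -/
  cap : Fin D → ℝ
  cap_nonneg : ∀ d, 0 ≤ cap d
  exists_cap_pos : ∃ d, 0 < cap d
  /-- The DPS weights. -/
  g : Fin K → ℝ
  g_pos : ∀ k, 0 < g k

namespace ModulatedDPS

variable {K D : ℕ} (S : ModulatedDPS K D)

/-- States `(m, d)`: numbers of customers of each class, and the state of the environment. -/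
abbrev State (K D : ℕ) : Type := (Fin K → ℕ) × Fin D

/-- `μ_{k,d} = μ_k c_d`. -/
def muMod (k : Fin K) (d : Fin D) : ℝ := S.mu k * S.cap d

/-- `λ_{k,∞} = ∑_d λ_{k,d} π_d` with `λ_{k,d} = α_{k,d} λ_d`. -/
noncomputable def lamAvg (k : Fin K) : ℝ := ∑ d, S.alpha k d * S.lam d * S.envDist d

/-- `μ_{k,∞} = ∑_d μ_{k,d} π_d`. -/
noncomputable def muAvg (k : Fin K) : ℝ := ∑ d, S.muMod k d * S.envDist d

/-- The traffic intensity `ρ_∞ = ∑_k λ_{k,∞} / μ_{k,∞}` of the unscaled system. -/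
noncomputable def rho : ℝ := ∑ k, S.lamAvg k / S.muAvg k

/-- `λ_d^{(N)} = (λ_d / ρ_∞) (1 - 1/N)`. -/
noncomputable def lamScaled (N : ℝ) (d : Fin D) : ℝ := S.lam d / S.rho * (1 - 1 / N)

/-- `λ_{k,d}^{(N)} = α_{k,d} λ_d^{(N)}`. -/
noncomputable def classLamScaled (N : ℝ) (k : Fin K) (d : Fin D) : ℝ :=
  S.alpha k d * S.lamScaled N d

/-- Fraction `g_k m_k / ∑_j g_j m_j` of the capacity that is given to class `k`
(it is `0` in the empty system). -/
noncomputable def share (m : Fin K → ℕ) (k : Fin K) : ℝ :=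
  S.g k * m k / ∑ j, S.g j * m j

/-- Transition rate from `x` to `y`, for `x ≠ y` (it is `0` for `x = y`), of the continuous-time
Markov chain of queue lengths and environment in the `N`-th system: arrivals, service completions
and changes of the environment. -/
noncomputable def transitionRate (N : ℝ) (x y : State K D) : ℝ :=
  (∑ k, if y = (x.1 + Pi.single k 1, x.2) then S.classLamScaled N k x.2 else 0)
  + (∑ k, if 0 < x.1 k ∧ y = (x.1 - Pi.single k 1, x.2) then
      S.share x.1 k * S.muMod k x.2 else 0)
  + (if y.1 = x.1 ∧ y.2 ≠ x.2 then S.Q x.2 y.2 else 0)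

/-- `p` is a stationary distribution of the `N`-th system: a probability mass function for which
in every state the total flow out equals the total flow in. -/
structure IsStationary (N : ℝ) (p : State K D → ℝ) : Prop where
  nonneg : ∀ x, 0 ≤ p x
  hasSum_one : HasSum p 1
  balance : ∀ y, p y * ∑' x, S.transitionRate N y x = ∑' x, p x * S.transitionRate N x y

end ModulatedDPS

/-- Partial generating function `P_d(z) = E[z_1^{M_1} ⋯ z_K^{M_K} 1{Z = d}]` of the law `p` of
`(M, Z)`. -/
noncomputable def partialPGF {K D : ℕ} (p : ModulatedDPS.State K D → ℝ) (d : Fin D)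
    (z : Fin K → ℝ) : ℝ :=
  ∑' m : Fin K → ℕ, p (m, d) * ∏ k, z k ^ m k

/-! Under a stationary law every bounded function has mean drift zero (`hasSum_mul_drift`). Apply
this to `z^m 1{e = d}` at `z = e^{-s/N}`. An arrival or a departure of class `k` changes this
function by at most `1 - z_k`, at rates bounded over the states and convergent in `N`, so the
queueing part of the drift vanishes in the limit. The environment part has mean `∑_e P_e(z)
q_{e,d}`. Hence the limit vector is a left null vector of `Q` (`vecMul_Q_eq_zero`), and
irreducibility makes it a multiple of the invariant distribution (`eq_envDist_mul_sum`).

Independence follows because the partial Laplace transforms now factor, and a finite measure on the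
orthant is determined by its Laplace transform: the exponentials span a point-separating algebra
(`ext_of_integral_laplaceKernel`). -/

namespace ModulatedDPS

variable {K D : ℕ} (S : ModulatedDPS K D)

/-! ### Transition rates: signs, finite sums and bounded exit rates -/

lemma share_nonneg (m : Fin K → ℕ) (k : Fin K) : 0 ≤ S.share m k :=
  div_nonneg (mul_nonneg (S.g_pos k).le (Nat.cast_nonneg _))
    (Finset.sum_nonneg fun j _ => mul_nonneg (S.g_pos j).le (Nat.cast_nonneg _))

lemma share_le_one (m : Fin K → ℕ) (k : Fin K) : S.share m k ≤ 1 :=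
  div_le_one_of_le₀
    (Finset.single_le_sum (f := fun j => S.g j * (m j : ℝ))
      (fun j _ => mul_nonneg (S.g_pos j).le (Nat.cast_nonneg _)) (Finset.mem_univ k))
    (Finset.sum_nonneg fun j _ => mul_nonneg (S.g_pos j).le (Nat.cast_nonneg _))

lemma muMod_nonneg (k : Fin K) (d : Fin D) : 0 ≤ S.muMod k d :=
  mul_nonneg (S.mu_pos k).le (S.cap_nonneg d)

lemma rho_nonneg : 0 ≤ S.rho :=
  Finset.sum_nonneg fun k _ => div_nonneg
    (Finset.sum_nonneg fun d _ => mul_nonneg (mul_nonneg (S.alpha_nonneg k d) (S.lam_nonneg d))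
      (S.envDist_nonneg d))
    (Finset.sum_nonneg fun d _ => mul_nonneg (S.muMod_nonneg k d) (S.envDist_nonneg d))

lemma classLamScaled_nonneg {N : ℝ} (hN : 1 < N) (k : Fin K) (d : Fin D) :
    0 ≤ S.classLamScaled N k d := by
  have h : 1 / N ≤ 1 := by rw [div_le_one (by linarith)]; exact hN.le
  exact mul_nonneg (S.alpha_nonneg k d)
    (mul_nonneg (div_nonneg (S.lam_nonneg d) S.rho_nonneg) (by linarith))

lemma transitionRate_nonneg {N : ℝ} (hN : 1 < N) (x y : State K D) :
    0 ≤ S.transitionRate N x y := by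
  unfold transitionRate
  refine add_nonneg (add_nonneg (Finset.sum_nonneg fun k _ => ?_)
    (Finset.sum_nonneg fun k _ => ?_)) ?_
  · split_ifs
    exacts [S.classLamScaled_nonneg hN _ _, le_rfl]
  · split_ifs
    exacts [mul_nonneg (S.share_nonneg _ _) (S.muMod_nonneg _ _), le_rfl]
  · split_ifs with h
    exacts [S.Q_offDiag_nonneg _ _ (Ne.symm h.2), le_rfl]

/-- The sum `∑_y r(x, y) h(y)` over all transitions out of `x`. -/
noncomputable def jumpSum (N : ℝ) (h : State K D → ℝ) (x : State K D) : ℝ :=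
  (∑ k, S.classLamScaled N k x.2 * h (x.1 + Pi.single k 1, x.2))
  + (∑ k, if 0 < x.1 k then S.share x.1 k * S.muMod k x.2 * h (x.1 - Pi.single k 1, x.2) else 0)
  + ∑ e, if e ≠ x.2 then S.Q x.2 e * h (x.1, e) else 0

/-- Only finitely many states can be reached in one jump, so the series is a finite sum of point
masses. -/
lemma hasSum_transitionRate_mul (N : ℝ) (h : State K D → ℝ) (x : State K D) :
    HasSum (fun y => S.transitionRate N x y * h y) (S.jumpSum N h x) := by
  have key : (fun y => S.transitionRate N x y * h y) = fun y =>
      (∑ k, if y = (x.1 + Pi.single k 1, x.2) then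
        S.classLamScaled N k x.2 * h (x.1 + Pi.single k 1, x.2) else 0)
      + (∑ k, if y = (x.1 - Pi.single k 1, x.2) then
        (if 0 < x.1 k then
          S.share x.1 k * S.muMod k x.2 * h (x.1 - Pi.single k 1, x.2) else 0) else 0)
      + ∑ e, if y = (x.1, e) then (if e ≠ x.2 then S.Q x.2 e * h (x.1, e) else 0) else 0 := by
    funext y
    rw [transitionRate, add_mul, add_mul, Finset.sum_mul, Finset.sum_mul]
    congr 1
    · congr 1
      · refine Finset.sum_congr rfl fun k _ => ?_
        split_ifs with h1
        · rw [h1]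
        · simp
      · refine Finset.sum_congr rfl fun k _ => ?_
        by_cases h1 : y = (x.1 - Pi.single k 1, x.2)
        · simp only [← h1, and_true, if_true, ite_mul, zero_mul]
        · simp [h1]
    · obtain ⟨m, d⟩ := x
      obtain ⟨m', d'⟩ := y
      by_cases hm : m' = m
      · subst hm
        simp [Finset.sum_ite_eq, ite_mul]
      · simp [hm]
  rw [key]
  exact ((hasSum_sum fun k _ => hasSum_ite_eq _ _).add
    (hasSum_sum fun k _ => hasSum_ite_eq _ _)).add (hasSum_sum fun e _ => hasSum_ite_eq _ _)

lemma tsum_transitionRate (N : ℝ) (x : State K D) :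
    ∑' y, S.transitionRate N x y = S.jumpSum N (fun _ => 1) x := by
  simpa using (S.hasSum_transitionRate_mul N (fun _ => 1) x).tsum_eq

lemma summable_transitionRate (N : ℝ) (x : State K D) :
    Summable (S.transitionRate N x) := by
  simpa using (S.hasSum_transitionRate_mul N (fun _ => 1) x).summable

lemma jumpSum_one_nonneg {N : ℝ} (hN : 1 < N) (x : State K D) :
    0 ≤ S.jumpSum N (fun _ => 1) x := by
  rw [← tsum_transitionRate]
  exact tsum_nonneg (S.transitionRate_nonneg hN x)

/-- Shares are at most one, so the exit rate is bounded in the queue lengths; the sum over `d` is a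
crude maximum over the environment. This makes the total stationary flow finite. -/
lemma jumpSum_one_le {N : ℝ} (hN : 1 < N) (x : State K D) :
    S.jumpSum N (fun _ => 1) x ≤
      ∑ d, ((∑ k, S.classLamScaled N k d) + (∑ k, S.muMod k d) + ∑ e, |S.Q d e|) := by
  have h : S.jumpSum N (fun _ => 1) x ≤
      (∑ k, S.classLamScaled N k x.2) + (∑ k, S.muMod k x.2) + ∑ e, |S.Q x.2 e| := by
    unfold jumpSum
    refine add_le_add (add_le_add (Finset.sum_le_sum fun k _ => by simp)
      (Finset.sum_le_sum fun k _ => ?_)) (Finset.sum_le_sum fun e _ => ?_)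
    · split_ifs
      · rw [mul_one]
        exact mul_le_of_le_one_left (S.muMod_nonneg _ _) (S.share_le_one _ _)
      · exact S.muMod_nonneg _ _
    · split_ifs
      · rw [mul_one]; exact le_abs_self _
      · exact abs_nonneg _
  refine h.trans (Finset.single_le_sum (f := fun d => (∑ k, S.classLamScaled N k d) +
    (∑ k, S.muMod k d) + ∑ e, |S.Q d e|) (fun d _ => ?_) (Finset.mem_univ x.2))
  exact add_nonneg (add_nonneg (Finset.sum_nonneg fun k _ => S.classLamScaled_nonneg hN _ _)
    (Finset.sum_nonneg fun k _ => S.muMod_nonneg _ _)) (Finset.sum_nonneg fun _ _ => abs_nonneg _)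

/-! ### Stationarity as vanishing mean drift -/

namespace IsStationary

variable {S} {N : ℝ} {p : State K D → ℝ}

lemma summable_mul (hp : S.IsStationary N p) {a : State K D → ℝ} {C : ℝ}
    (ha : ∀ x, |a x| ≤ C) : Summable fun x => p x * a x := by
  refine Summable.of_norm_bounded (hp.hasSum_one.summable.mul_right C) fun x => ?_
  rw [Real.norm_eq_abs, abs_mul, abs_of_nonneg (hp.nonneg x)]
  exact mul_le_mul_of_nonneg_left (ha x) (hp.nonneg x)

/-- Absolute summability over pairs is what permits exchanging source and target in
`hasSum_mul_drift`. -/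
lemma summable_flow (hp : S.IsStationary N p) (hN : 1 < N) :
    Summable fun q : State K D × State K D => p q.1 * S.transitionRate N q.1 q.2 := by
  have hnn : 0 ≤ fun q : State K D × State K D => p q.1 * S.transitionRate N q.1 q.2 :=
    fun q => mul_nonneg (hp.nonneg q.1) (S.transitionRate_nonneg hN q.1 q.2)
  refine (summable_prod_of_nonneg hnn).2
    ⟨fun x => (S.summable_transitionRate N x).mul_left (p x), ?_⟩
  have hsum : (fun x => ∑' y, p x * S.transitionRate N x y) =
      fun x => p x * S.jumpSum N (fun _ => 1) x := by
    funext x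
    rw [tsum_mul_left, tsum_transitionRate]
  change Summable fun x => ∑' y, p x * S.transitionRate N x y
  rw [hsum]
  refine hp.summable_mul (C := ∑ d, ((∑ k, S.classLamScaled N k d) + (∑ k, S.muMod k d) +
    ∑ e, |S.Q d e|)) fun x => ?_
  rw [abs_of_nonneg (S.jumpSum_one_nonneg hN x)]
  exact S.jumpSum_one_le hN x

/-- The mean drift of a bounded function under a stationary distribution is zero. -/
lemma hasSum_mul_drift (hp : S.IsStationary N p) (hN : 1 < N) {f : State K D → ℝ} {C : ℝ}
    (hf : ∀ x, |f x| ≤ C) :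
    HasSum (fun x => p x * (S.jumpSum N f x - S.jumpSum N (fun _ => 1) x * f x)) 0 := by
  have hF : Summable fun q : State K D × State K D =>
      p q.1 * S.transitionRate N q.1 q.2 * f q.2 := by
    refine Summable.of_norm_bounded ((hp.summable_flow hN).mul_right C) fun q => ?_
    have h0 := mul_nonneg (hp.nonneg q.1) (S.transitionRate_nonneg hN q.1 q.2)
    rw [Real.norm_eq_abs, abs_mul, abs_of_nonneg h0]
    exact mul_le_mul_of_nonneg_left (hf _) h0
  have h1 : ∀ x, ∑' y, p x * S.transitionRate N x y * f y = p x * S.jumpSum N f x := fun x => by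
    simp_rw [mul_assoc]
    rw [tsum_mul_left, (S.hasSum_transitionRate_mul N f x).tsum_eq]
  -- Summing over sources first, the balance equation replaces the inflow into `y` by the outflow.
  have h2 : ∀ y, ∑' x, p x * S.transitionRate N x y * f y =
      p y * (S.jumpSum N (fun _ => 1) y * f y) := fun y => by
    rw [tsum_mul_right, ← hp.balance y, tsum_transitionRate, mul_assoc]
  have hs1 : HasSum (fun x => p x * S.jumpSum N f x)
      (∑' q : State K D × State K D, p q.1 * S.transitionRate N q.1 q.2 * f q.2) :=
    hF.hasSum.prod_fiberwise fun x => by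
      rw [← h1]; exact (hF.prod_factor x).hasSum
  have hF' := hF.prod_symm
  have hs2 : HasSum (fun y => p y * (S.jumpSum N (fun _ => 1) y * f y))
      (∑' q : State K D × State K D, p q.1 * S.transitionRate N q.1 q.2 * f q.2) := by
    rw [← (Equiv.prodComm (State K D) (State K D)).tsum_eq]
    exact hF'.hasSum.prod_fiberwise fun y => by
      rw [← h2]; exact (hF'.prod_factor y).hasSum
  simpa [mul_sub] using hs1.sub hs2

end IsStationary

/-! ### Drift of monomials and the key estimate -/

/-- The function `(m, e) ↦ z^m 1{e = d}`. -/
noncomputable def monomialAt (d : Fin D) (z : Fin K → ℝ) (x : State K D) : ℝ :=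
  if x.2 = d then ∏ k, z k ^ x.1 k else 0

lemma prod_pow_add_single (z : Fin K → ℝ) (m : Fin K → ℕ) (k : Fin K) :
    ∏ j, z j ^ (m + Pi.single k 1 : Fin K → ℕ) j = (∏ j, z j ^ m j) * z k := by
  simp_rw [Pi.add_apply, pow_add]
  rw [Finset.prod_mul_distrib]
  congr 1
  rw [Finset.prod_eq_single k] <;> simp +contextual

lemma prod_pow_mem {z : Fin K → ℝ} (hz : ∀ k, z k ∈ Set.Icc (0 : ℝ) 1) (m : Fin K → ℕ) :
    ∏ j, z j ^ m j ∈ Set.Icc (0 : ℝ) 1 :=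
  ⟨Finset.prod_nonneg fun j _ => pow_nonneg (hz j).1 _,
    Finset.prod_le_one (fun j _ => pow_nonneg (hz j).1 _) fun j _ => pow_le_one₀ (hz j).1 (hz j).2⟩

lemma abs_monomialAt_le {z : Fin K → ℝ} (hz : ∀ k, z k ∈ Set.Icc (0 : ℝ) 1) (d : Fin D)
    (x : State K D) : |monomialAt d z x| ≤ 1 := by
  unfold monomialAt
  split_ifs
  · rw [abs_of_nonneg (prod_pow_mem hz _).1]; exact (prod_pow_mem hz _).2
  · simp

lemma abs_monomialAt_add_single_sub_le {z : Fin K → ℝ} (hz : ∀ k, z k ∈ Set.Icc (0 : ℝ) 1)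
    (d : Fin D) (m : Fin K → ℕ) (e : Fin D) (k : Fin K) :
    |monomialAt d z (m + Pi.single k 1, e) - monomialAt d z (m, e)| ≤ 1 - z k := by
  have hz1 : 0 ≤ 1 - z k := by linarith [(hz k).2]
  unfold monomialAt
  simp only
  split_ifs
  · have := prod_pow_mem hz m
    rw [prod_pow_add_single, show (∏ j, z j ^ m j) * z k - ∏ j, z j ^ m j =
      -((∏ j, z j ^ m j) * (1 - z k)) by ring, abs_neg, abs_of_nonneg (mul_nonneg this.1 hz1)]
    exact mul_le_of_le_one_left hz1 this.2
  · simpa using hz1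

/-- A departure is an arrival reversed; `0 < m k` keeps the truncated subtraction exact. -/
lemma abs_monomialAt_sub_single_sub_le {z : Fin K → ℝ} (hz : ∀ k, z k ∈ Set.Icc (0 : ℝ) 1)
    (d : Fin D) {m : Fin K → ℕ} (e : Fin D) {k : Fin K} (hm : 0 < m k) :
    |monomialAt d z (m - Pi.single k 1, e) - monomialAt d z (m, e)| ≤ 1 - z k := by
  have h : m - Pi.single k 1 + Pi.single k 1 = m := by
    funext j
    by_cases hj : j = k
    · subst hj; simp; omega
    · simp [hj]
  have := abs_monomialAt_add_single_sub_le hz d (m - Pi.single k 1) e k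
  rwa [h, abs_sub_comm] at this

/-- Up to a bounded remainder that vanishes as `z → 1`, the drift of `z^m 1{e = d}` is
`q_{e,d} z^m`. -/
lemma abs_drift_monomialAt_sub_le {N : ℝ} (hN : 1 < N) {z : Fin K → ℝ}
    (hz : ∀ k, z k ∈ Set.Icc (0 : ℝ) 1) (d : Fin D) (x : State K D) :
    |S.jumpSum N (monomialAt d z) x - S.jumpSum N (fun _ => 1) x * monomialAt d z x
      - S.Q x.2 d * ∏ k, z k ^ x.1 k| ≤
      ∑ k, (∑ e, (S.classLamScaled N k e + S.muMod k e)) * (1 - z k) := by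
  obtain ⟨m, c⟩ := x
  -- Since rows of `Q` sum to zero, the diagonal entry is minus the exit rate, and the sums over `e
  -- ≠ c` combine into one over all `e`, where only `e = d` survives.
  have henv : (∑ e, if e ≠ c then S.Q c e * monomialAt d z (m, e) else 0)
      - (∑ e, if e ≠ c then S.Q c e * 1 else 0) * monomialAt d z (m, c)
      = S.Q c d * ∏ k, z k ^ m k := by
    have h1 : S.Q c d * ∏ k, z k ^ m k = ∑ e, S.Q c e * monomialAt d z (m, e) := by
      simp [monomialAt]
    have h2 : ∑ e, S.Q c e * monomialAt d z (m, c) = 0 := by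
      rw [← Finset.sum_mul, S.Q_row_sum, zero_mul]
    rw [h1]
    refine Eq.trans ?_ ((congrArg (fun t => (∑ e, S.Q c e * monomialAt d z (m, e)) - t) h2).trans
      (sub_zero _))
    rw [Finset.sum_mul, ← Finset.sum_sub_distrib, ← Finset.sum_sub_distrib]
    refine Finset.sum_congr rfl fun e _ => ?_
    by_cases he : e = c
    · subst he; simp
    · simp [he]
  have hd : S.jumpSum N (monomialAt d z) (m, c) - S.jumpSum N (fun _ => 1) (m, c) *
      monomialAt d z (m, c) - S.Q c d * ∏ k, z k ^ m k =
      ∑ k, (S.classLamScaled N k c *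
          (monomialAt d z (m + Pi.single k 1, c) - monomialAt d z (m, c)) +
        if 0 < m k then S.share m k * S.muMod k c *
          (monomialAt d z (m - Pi.single k 1, c) - monomialAt d z (m, c)) else 0) := by
    have e1 : ∑ k, S.classLamScaled N k c *
          (monomialAt d z (m + Pi.single k 1, c) - monomialAt d z (m, c)) =
        (∑ k, S.classLamScaled N k c * monomialAt d z (m + Pi.single k 1, c)) -
        (∑ k, S.classLamScaled N k c * 1) * monomialAt d z (m, c) := by
      rw [Finset.sum_mul, ← Finset.sum_sub_distrib]
      exact Finset.sum_congr rfl fun k _ => by ring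
    have e2 : (∑ k, if 0 < m k then S.share m k * S.muMod k c *
          (monomialAt d z (m - Pi.single k 1, c) - monomialAt d z (m, c)) else 0) =
        (∑ k, if 0 < m k then S.share m k * S.muMod k c *
          monomialAt d z (m - Pi.single k 1, c) else 0) -
        (∑ k, if 0 < m k then S.share m k * S.muMod k c * 1 else 0) * monomialAt d z (m, c) := by
      rw [Finset.sum_mul, ← Finset.sum_sub_distrib]
      exact Finset.sum_congr rfl fun k _ => by split_ifs <;> ring
    rw [Finset.sum_add_distrib, e1, e2, ← henv]
    simp only [jumpSum]
    ring
  rw [hd]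
  refine (Finset.abs_sum_le_sum_abs _ _).trans (Finset.sum_le_sum fun k _ => ?_)
  have hz1 : 0 ≤ 1 - z k := by linarith [(hz k).2]
  have hl := S.classLamScaled_nonneg hN k c
  have hmu := S.muMod_nonneg k c
  calc _ ≤ S.classLamScaled N k c * (1 - z k) + S.muMod k c * (1 - z k) := by
        refine (abs_add_le _ _).trans (add_le_add ?_ ?_)
        · rw [abs_mul, abs_of_nonneg hl]
          exact mul_le_mul_of_nonneg_left (abs_monomialAt_add_single_sub_le hz d m c k) hl
        · split_ifs with h
          · have hs := mul_nonneg (S.share_nonneg m k) hmu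
            rw [abs_mul, abs_of_nonneg hs]
            exact mul_le_mul (mul_le_of_le_one_left hmu (S.share_le_one m k))
              (abs_monomialAt_sub_single_sub_le hz d c h) (abs_nonneg _) hmu
          · simpa using mul_nonneg hmu hz1
    _ = (S.classLamScaled N k c + S.muMod k c) * (1 - z k) := by ring
    _ ≤ _ := mul_le_mul_of_nonneg_right (Finset.single_le_sum
        (f := fun e => S.classLamScaled N k e + S.muMod k e)
        (fun e _ => add_nonneg (S.classLamScaled_nonneg hN k e) (S.muMod_nonneg k e))
        (Finset.mem_univ c)) hz1

lemma IsStationary.hasSum_Q_mul {S : ModulatedDPS K D} {N : ℝ} {p : State K D → ℝ}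
    (hp : S.IsStationary N p) {z : Fin K → ℝ}
    (hz : ∀ k, z k ∈ Set.Icc (0 : ℝ) 1) (d : Fin D) :
    HasSum (fun x : State K D => p x * (S.Q x.2 d * ∏ k, z k ^ x.1 k))
      (∑ e, partialPGF p e z * S.Q e d) := by
  have hs : Summable fun x : State K D => p x * (S.Q x.2 d * ∏ k, z k ^ x.1 k) := by
    refine hp.summable_mul (C := ∑ e, |S.Q e d|) fun x => ?_
    have h1 := prod_pow_mem hz x.1
    rw [abs_mul, abs_of_nonneg h1.1]
    exact (mul_le_of_le_one_right (abs_nonneg _) h1.2).trans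
      (Finset.single_le_sum (f := fun e => |S.Q e d|) (fun _ _ => abs_nonneg _)
        (Finset.mem_univ x.2))
  have hs' := hs.prod_symm
  have hval : ∑' x : State K D, p x * (S.Q x.2 d * ∏ k, z k ^ x.1 k) =
      ∑ e, partialPGF p e z * S.Q e d := by
    rw [← (Equiv.prodComm (Fin D) (Fin K → ℕ)).tsum_eq]
    refine (hs'.tsum_prod).trans ?_
    rw [tsum_fintype]
    refine Finset.sum_congr rfl fun e _ => ?_
    rw [partialPGF, ← tsum_mul_right]
    exact tsum_congr fun m => by simp only [Prod.swap]; ring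
  exact hval ▸ hs.hasSum

/-- The mean drift is zero, so the environment term is minus the mean of the remainder bounded
pointwise in `abs_drift_monomialAt_sub_le`, and `p` has mass one. -/
lemma IsStationary.abs_sum_partialPGF_mul_Q_le {S : ModulatedDPS K D} {N : ℝ}
    {p : State K D → ℝ} (hp : S.IsStationary N p) (hN : 1 < N) {z : Fin K → ℝ}
    (hz : ∀ k, z k ∈ Set.Icc (0 : ℝ) 1) (d : Fin D) :
    |∑ e, partialPGF p e z * S.Q e d| ≤
      ∑ k, (∑ e, (S.classLamScaled N k e + S.muMod k e)) * (1 - z k) := by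
  have h := (hp.hasSum_mul_drift hN (abs_monomialAt_le hz d)).sub (hp.hasSum_Q_mul hz d)
  rw [zero_sub] at h
  rw [← abs_neg, ← h.tsum_eq]
  have hb := hp.hasSum_one.mul_right
    (∑ k, (∑ e, (S.classLamScaled N k e + S.muMod k e)) * (1 - z k))
  rw [one_mul] at hb
  rw [← Real.norm_eq_abs]
  refine tsum_of_norm_bounded hb fun x => ?_
  rw [← mul_sub, norm_mul, Real.norm_of_nonneg (hp.nonneg x)]
  exact mul_le_mul_of_nonneg_left (S.abs_drift_monomialAt_sub_le hN hz d x) (hp.nonneg x)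

/-! ### Heavy-traffic limit and null vectors of the generator -/

lemma tendsto_remainder (s : Fin K → ℝ) :
    Tendsto (fun N : ℝ => ∑ k, (∑ e, (S.classLamScaled N k e + S.muMod k e)) *
      (1 - Real.exp (-s k / N))) atTop (𝓝 0) := by
  have h1 : Tendsto (fun N : ℝ => 1 / N) atTop (𝓝 0) := by
    simpa using tendsto_inv_atTop_zero (𝕜 := ℝ)
  have h : ∀ k, Tendsto (fun N : ℝ => (∑ e, (S.classLamScaled N k e + S.muMod k e)) *
      (1 - Real.exp (-s k / N))) atTop (𝓝 ((∑ e, (S.alpha k e * (S.lam e / S.rho * (1 - 0))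
        + S.muMod k e)) * (1 - Real.exp 0))) := fun k => by
    refine Tendsto.mul (tendsto_finsetSum _ fun e _ => Tendsto.add_const _
      (Tendsto.const_mul _ (Tendsto.const_mul _ (h1.const_sub 1)))) (Tendsto.const_sub _
        ((Real.continuous_exp.tendsto 0).comp (tendsto_const_nhds.div_atTop tendsto_id)))
  simpa using tendsto_finsetSum Finset.univ fun k _ => h k

/-- The limiting partial generating functions form a left null vector of the generator. -/
lemma vecMul_Q_eq_zero {p : ℝ → State K D → ℝ} (hp : ∀ N : ℝ, 1 < N → S.IsStationary N (p N))
    {l : Filter ℝ} [l.NeBot] (hl : l ≤ atTop) {s : Fin K → ℝ} (hs : ∀ k, 0 ≤ s k)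
    {Phat : Fin D → ℝ}
    (h : ∀ d, Tendsto (fun N : ℝ => partialPGF (p N) d (fun k => Real.exp (-s k / N))) l
      (𝓝 (Phat d))) :
    Matrix.vecMul Phat S.Q = 0 := by
  funext d
  have h1 : Tendsto (fun N : ℝ =>
      ∑ e, partialPGF (p N) e (fun k => Real.exp (-s k / N)) * S.Q e d) l
      (𝓝 (∑ e, Phat e * S.Q e d)) :=
    tendsto_finsetSum _ fun e _ => (h e).mul_const _
  have h2 : Tendsto (fun N : ℝ =>
      ∑ e, partialPGF (p N) e (fun k => Real.exp (-s k / N)) * S.Q e d) l (𝓝 0) := by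
    refine squeeze_zero_norm' ?_ ((S.tendsto_remainder s).mono_left hl)
    filter_upwards [hl (eventually_gt_atTop 1)] with N hN
    refine (hp N hN).abs_sum_partialPGF_mul_Q_le hN (fun k => ⟨(Real.exp_pos _).le, ?_⟩) d
    rw [Real.exp_le_one_iff]
    exact div_nonpos_of_nonpos_of_nonneg (by linarith [hs k]) (by linarith)
  exact tendsto_nhds_unique h1 h2

/-- A nonnegative left null vector of the generator that vanishes somewhere is zero. -/
lemma eq_zero_of_vecMul_Q_eq_zero {w : Fin D → ℝ} (hw : ∀ d, 0 ≤ w d)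
    (hwQ : Matrix.vecMul w S.Q = 0) {j : Fin D} (hj : w j = 0) : w = 0 := by
  -- Zeros propagate backwards along positive rates: when `w b = 0` the negative diagonal term drops
  -- out of column `b`, leaving nonnegative terms with sum zero.
  have hstep : ∀ a b, a ≠ b ∧ 0 < S.Q a b → w b = 0 → w a = 0 := by
    rintro a b ⟨-, hab⟩ hb
    have h0 : ∑ e, w e * S.Q e b = 0 := congrFun hwQ b
    have hnn : ∀ e ∈ Finset.univ, 0 ≤ w e * S.Q e b := fun e _ => by
      by_cases he : e = b
      · simp [he, hb]
      · exact mul_nonneg (hw e) (S.Q_offDiag_nonneg e b he)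
    have := (Finset.sum_eq_zero_iff_of_nonneg hnn).1 h0 a (Finset.mem_univ a)
    exact (mul_eq_zero.1 this).resolve_right hab.ne'
  funext i
  induction S.Q_irreducible i j using Relation.ReflTransGen.head_induction_on with
  | refl => exact hj
  | head h _ ih => exact hstep _ _ h ih

lemma envDist_pos (d : Fin D) : 0 < S.envDist d := by
  refine lt_of_le_of_ne (S.envDist_nonneg d) fun h => ?_
  have h0 := S.eq_zero_of_vecMul_Q_eq_zero S.envDist_nonneg S.envDist_invariant h.symm
  simpa [h0] using S.envDist_sum

/-- Left null vectors of the generator are multiples of the invariant distribution. -/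
lemma eq_envDist_mul_sum {v : Fin D → ℝ} (hv : Matrix.vecMul v S.Q = 0) (d : Fin D) :
    v d = S.envDist d * ∑ e, v e := by
  -- The minimal ratio is the largest multiple of `envDist` whose subtraction leaves a nonnegative
  -- vector; the difference vanishes at the minimizer.
  obtain ⟨j, -, hj⟩ := Finset.exists_min_image Finset.univ (fun e => v e / S.envDist e)
    ⟨d, Finset.mem_univ d⟩
  have hw : v - (v j / S.envDist j) • S.envDist = 0 := by
    refine S.eq_zero_of_vecMul_Q_eq_zero (j := j) (fun e => ?_) ?_ ?_
    · have := (le_div_iff₀ (S.envDist_pos e)).1 (hj e (Finset.mem_univ e))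
      simpa using this
    · rw [Matrix.sub_vecMul, Matrix.smul_vecMul, hv, S.envDist_invariant]; simp
    · simp [div_mul_cancel₀ _ (S.envDist_pos j).ne']
  have hv' : ∀ e, v e = v j / S.envDist j * S.envDist e := fun e => by
    simpa [sub_eq_zero] using congrFun hw e
  have hsum : ∑ e, v e = v j / S.envDist j := by
    rw [Finset.sum_congr rfl fun e _ => hv' e, ← Finset.mul_sum, S.envDist_sum, mul_one]
  rw [hsum, mul_comm]; exact hv' d

end ModulatedDPS
-- Uniqueness of Laplace transforms on the orthant
open scoped NNReal BoundedContinuousFunction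

section Laplace

variable {ι : Type*} [Fintype ι]

/-- The function `x ↦ e^{-s·x}` on the nonnegative orthant. -/
noncomputable def laplaceKernel (s : ι → ℝ≥0) : (ι → ℝ≥0) →ᵇ ℝ :=
  BoundedContinuousFunction.ofNormedAddCommGroup
    (fun x => Real.exp (-∑ k, (s k : ℝ) * x k)) (by fun_prop) 1 fun x => by
      rw [Real.norm_of_nonneg (Real.exp_pos _).le, Real.exp_le_one_iff, neg_nonpos]
      positivity

lemma laplaceKernel_apply (s x : ι → ℝ≥0) :
    laplaceKernel s x = Real.exp (-∑ k, (s k : ℝ) * x k) := rfl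

lemma laplaceKernel_add (s t : ι → ℝ≥0) :
    laplaceKernel (s + t) = laplaceKernel s * laplaceKernel t := by
  ext x
  simp only [laplaceKernel_apply, BoundedContinuousFunction.mul_apply, ← Real.exp_add]
  congr 1
  simp only [Pi.add_apply, NNReal.coe_add, add_mul, Finset.sum_add_distrib]
  ring

lemma laplaceKernel_zero : laplaceKernel (0 : ι → ℝ≥0) = 1 := by
  ext x; simp [laplaceKernel_apply]

/-- The algebra generated by the exponentials on the nonnegative orthant. -/
noncomputable def laplaceAlgebra (ι : Type*) [Fintype ι] : StarSubalgebra ℝ ((ι → ℝ≥0) →ᵇ ℝ) where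
  toSubalgebra := Algebra.adjoin ℝ (Set.range laplaceKernel)
  star_mem' {a} ha := by
    have : star a = a := by ext x; simp
    rwa [this]

/-- Exponentials are closed under products and include `1`, so linear combinations already form the
algebra; equality of integrals then extends by linearity. -/
lemma mem_span_of_mem_laplaceAlgebra {f : (ι → ℝ≥0) →ᵇ ℝ} (hf : f ∈ laplaceAlgebra ι) :
    f ∈ Submodule.span ℝ (Set.range (laplaceKernel (ι := ι))) := by
  have hf' : f ∈ Subalgebra.toSubmodule
      (Algebra.adjoin ℝ (Set.range (laplaceKernel (ι := ι)))) := hf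
  rw [Algebra.adjoin_eq_span] at hf'
  refine Submodule.span_mono (fun g hg => ?_) hf'
  induction hg using Submonoid.closure_induction with
  | mem x hx => exact hx
  | one => exact ⟨0, laplaceKernel_zero⟩
  | mul x y _ _ hx hy =>
    obtain ⟨s, rfl⟩ := hx
    obtain ⟨t, rfl⟩ := hy
    exact ⟨s + t, laplaceKernel_add s t⟩

lemma laplaceAlgebra_separatesPoints :
    ((laplaceAlgebra ι).map
      (BoundedContinuousFunction.toContinuousMapStarₐ ℝ)).SeparatesPoints := by
  classical
  intro x y hxy
  obtain ⟨k, hk⟩ := Function.ne_iff.1 hxy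
  refine ⟨laplaceKernel (Pi.single k 1), ⟨laplaceKernel (Pi.single k 1), ?_, ?_⟩, ?_⟩
  · exact ⟨_, Algebra.subset_adjoin ⟨Pi.single k 1, rfl⟩, rfl⟩
  · rfl
  · have h : ∀ u : ι → ℝ≥0, laplaceKernel (Pi.single k 1) u = Real.exp (-u k) := fun u => by
      rw [laplaceKernel_apply]
      congr 2
      rw [Finset.sum_eq_single k] <;> simp +contextual
    rw [h, h]
    simpa using hk

/-- Finite measures on the nonnegative orthant with the same Laplace transform are equal. -/
theorem MeasureTheory.Measure.ext_of_integral_laplaceKernel {μ ν : Measure (ι → ℝ≥0)}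
    [IsFiniteMeasure μ] [IsFiniteMeasure ν]
    (h : ∀ s, ∫ x, laplaceKernel s x ∂μ = ∫ x, laplaceKernel s x ∂ν) : μ = ν := by
  refine ext_of_forall_mem_subalgebra_integral_eq_of_pseudoEMetric_complete_countable
    (𝕜 := ℝ) (A := laplaceAlgebra ι) laplaceAlgebra_separatesPoints fun f hf => ?_
  have hspan := mem_span_of_mem_laplaceAlgebra hf
  clear hf
  induction hspan using Submodule.span_induction with
  | mem f hf => obtain ⟨s, rfl⟩ := hf; exact h s
  | zero => simp
  | add f g _ _ hf hg =>
    simp only [BoundedContinuousFunction.add_apply]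
    rw [integral_add (f.integrable μ) (g.integrable μ),
      integral_add (f.integrable ν) (g.integrable ν), hf, hg]
  | smul c f _ hf =>
    simp only [BoundedContinuousFunction.coe_smul]
    rw [integral_smul, integral_smul, hf]

/-- The Laplace transform of a finite measure is right-continuous. -/
lemma tendsto_integral_laplaceKernel_add (μ : Measure (ι → ℝ≥0)) [IsFiniteMeasure μ]
    (s : ι → ℝ≥0) :
    Tendsto (fun n : ℕ => ∫ x, laplaceKernel (fun k => s k + 1 / ((n : ℝ≥0) + 1)) x ∂μ) atTop
      (𝓝 (∫ x, laplaceKernel s x ∂μ)) := by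
  refine tendsto_integral_of_dominated_convergence (fun _ => 1)
    (fun n => (laplaceKernel _).continuous.aestronglyMeasurable) (integrable_const _)
    (fun n => .of_forall fun x => ?_) (.of_forall fun x => ?_)
  · rw [laplaceKernel_apply, Real.norm_of_nonneg (Real.exp_pos _).le, Real.exp_le_one_iff,
      neg_nonpos]
    positivity
  · simp only [laplaceKernel_apply]
    refine (Real.continuous_exp.tendsto _).comp (Tendsto.neg (tendsto_finsetSum _ fun k _ => ?_))
    refine Tendsto.mul_const _ ?_
    simpa using (tendsto_one_div_add_atTop_nhds_zero_nat (𝕜 := ℝ)).const_add (s k : ℝ)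

/-- Finite measures on the nonnegative orthant whose Laplace transforms agree on the interior of
the orthant are equal. -/
theorem MeasureTheory.Measure.ext_of_integral_laplaceKernel_of_pos {μ ν : Measure (ι → ℝ≥0)}
    [IsFiniteMeasure μ] [IsFiniteMeasure ν]
    (h : ∀ s : ι → ℝ≥0, (∀ k, 0 < s k) →
      ∫ x, laplaceKernel s x ∂μ = ∫ x, laplaceKernel s x ∂ν) : μ = ν := by
  refine ext_of_integral_laplaceKernel fun s => ?_
  -- Boundary points `s` are limits of the interior points `s + 1/(n+1)`.
  refine tendsto_nhds_unique (tendsto_integral_laplaceKernel_add μ s) ?_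
  refine (tendsto_integral_laplaceKernel_add ν s).congr fun n => (h _ fun k => ?_).symm
  positivity

end Laplace

/-! ### From factored transforms to independence -/

section Independence

variable {Ω ι κ : Type*} [MeasurableSpace Ω] [Fintype ι] [Fintype κ] [MeasurableSpace κ]
  [MeasurableSingletonClass κ]

/-- If the partial Laplace transforms of a nonnegative vector factor with constants `c d` of sum
one, then the vector is independent of the discrete variable, whose law is given by `c`. -/
theorem indepFun_of_partial_laplace {P : Measure Ω} [IsProbabilityMeasure P]
    {M : Ω → ι → ℝ} {Z : Ω → κ} (hM : Measurable M) (hZ : Measurable Z)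
    (hM0 : ∀ᵐ ω ∂P, ∀ k, 0 ≤ M ω k) {c : κ → ℝ} (hc : ∀ d, 0 ≤ c d)
    (h : ∀ s : ι → ℝ, (∀ k, 0 < s k) → ∀ d,
      ∫ ω in Z ⁻¹' {d}, Real.exp (-∑ k, s k * M ω k) ∂P =
        c d * ∫ ω, Real.exp (-∑ k, s k * M ω k) ∂P) :
    IndepFun M Z P ∧ ∀ d, P.real (Z ⁻¹' {d}) = c d := by
  -- The positive part takes values in the orthant everywhere and equals `M` almost surely.
  set M' : Ω → ι → ℝ≥0 := fun ω k => (M ω k).toNNReal with hM'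
  have hmeas : Measurable M' := measurable_pi_lambda _ fun k =>
    ((measurable_pi_apply k).comp hM).real_toNNReal
  have hae : ∀ᵐ ω ∂P, (fun k => (M' ω k : ℝ)) = M ω := by
    filter_upwards [hM0] with ω hω
    funext k
    exact Real.coe_toNNReal _ (hω k)
  have hlaw : ∀ d, (P.restrict (Z ⁻¹' {d})).map M' = (c d).toNNReal • P.map M' := fun d => by
    refine Measure.ext_of_integral_laplaceKernel_of_pos fun s hs => ?_
    rw [integral_smul_nnreal_measure,
      integral_map hmeas.aemeasurable (laplaceKernel s).continuous.aestronglyMeasurable,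
      integral_map hmeas.aemeasurable (laplaceKernel s).continuous.aestronglyMeasurable,
      NNReal.smul_def, Real.coe_toNNReal _ (hc d), smul_eq_mul]
    have hk : (fun ω => laplaceKernel s (M' ω)) =ᵐ[P]
        fun ω => Real.exp (-∑ k, (s k : ℝ) * M ω k) := by
      filter_upwards [hae] with ω hω
      change Real.exp (-∑ k, (s k : ℝ) * (fun k => (M' ω k : ℝ)) k) = _
      rw [hω]
    rw [integral_congr_ae hk, integral_congr_ae (ae_restrict_of_ae hk)]
    exact h (fun k => s k) (fun k => hs k) d
  have hfac : ∀ d, ∀ A, MeasurableSet A →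
      P (M' ⁻¹' A ∩ Z ⁻¹' {d}) = (c d).toNNReal * P (M' ⁻¹' A) := fun d A hA => by
    have := congrArg (fun μ : Measure (ι → ℝ≥0) => μ A) (hlaw d)
    simp only [Measure.smul_apply] at this
    rwa [Measure.map_apply hmeas hA, Measure.map_apply hmeas hA,
      Measure.restrict_apply (hmeas hA), ENNReal.smul_def, smul_eq_mul] at this
  -- Taking `A` to be everything identifies `c` as the law of `Z`.
  have hZd : ∀ d, P (Z ⁻¹' {d}) = (c d).toNNReal := fun d => by
    simpa using hfac d Set.univ MeasurableSet.univ
  refine ⟨?_, fun d => by simp [Measure.real, hZd d, hc d]⟩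
  have hind : IndepFun M' Z P := by
    rw [indepFun_iff_measure_inter_preimage_eq_mul]
    intro A B hA hB
    have hdec : ∀ E : Set Ω, MeasurableSet E →
        P (E ∩ Z ⁻¹' B) = ∑ d ∈ B.toFinite.toFinset, P (E ∩ Z ⁻¹' {d}) := fun E hE => by
      rw [← measure_biUnion_finset]
      · congr 1
        ext ω
        simp
      · intro a _ b _ hab
        exact ((Set.disjoint_singleton.2 hab).preimage Z).mono Set.inter_subset_right
          Set.inter_subset_right
      · exact fun d _ => hE.inter (hZ (measurableSet_singleton d))
    rw [hdec _ (hmeas hA), ← Set.univ_inter (Z ⁻¹' B), hdec _ MeasurableSet.univ, Finset.mul_sum]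
    refine Finset.sum_congr rfl fun d _ => ?_
    rw [hfac d A hA, Set.univ_inter, hZd d, mul_comm]
  have hcoe : Measurable fun x : ι → ℝ≥0 => fun k => (x k : ℝ) := by fun_prop
  exact (hind.comp hcoe measurable_id).congr hae .rfl

end Independence

theorem mainTheorem6 {K D : ℕ} (S : ModulatedDPS K D)
    (p : ℝ → ModulatedDPS.State K D → ℝ)
    (hp : ∀ N : ℝ, 1 < N → S.IsStationary N (p N))
    (l : Filter ℝ) [l.NeBot] (hl : l ≤ atTop) :
    (∀ (s : Fin K → ℝ), (∀ k, 0 ≤ s k) → ∀ Phat : Fin D → ℝ,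
      (∀ d, Tendsto (fun N : ℝ => partialPGF (p N) d (fun k => Real.exp (-s k / N))) l
        (𝓝 (Phat d))) →
      ∀ d, Phat d = S.envDist d * ∑ e, Phat e) ∧
    (∀ {Ω : Type*} [MeasurableSpace Ω] (P : Measure Ω) [IsProbabilityMeasure P]
      (Mhat : Ω → Fin K → ℝ) (Zhat : Ω → Fin D), Measurable Mhat → Measurable Zhat →
      (∀ᵐ ω ∂P, ∀ k, 0 ≤ Mhat ω k) →
      (∀ s : Fin K → ℝ, (∀ k, 0 < s k) → ∀ d,
        Tendsto (fun N : ℝ => partialPGF (p N) d (fun k => Real.exp (-s k / N))) l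
          (𝓝 (∫ ω in Zhat ⁻¹' {d}, Real.exp (-∑ k, s k * Mhat ω k) ∂P))) →
      IndepFun Mhat Zhat P ∧ ∀ d, P.real (Zhat ⁻¹' {d}) = S.envDist d) := by
  have hpart : ∀ (s : Fin K → ℝ), (∀ k, 0 ≤ s k) → ∀ Phat : Fin D → ℝ,
      (∀ d, Tendsto (fun N : ℝ => partialPGF (p N) d (fun k => Real.exp (-s k / N))) l
        (𝓝 (Phat d))) →
      ∀ d, Phat d = S.envDist d * ∑ e, Phat e :=
    fun s hs Phat h => S.eq_envDist_mul_sum (S.vecMul_Q_eq_zero hp hl hs h)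
  refine ⟨hpart, fun {Ω} _ P _ Mhat Zhat hM hZ hM0 h => ?_⟩
  refine indepFun_of_partial_laplace hM hZ hM0 S.envDist_nonneg fun s hs d => ?_
  rw [hpart s (fun k => (hs k).le) _ (h s hs) d]
  congr 1
  have hint : Integrable (fun ω => Real.exp (-∑ k, s k * Mhat ω k)) P := by
    refine Integrable.of_bound (by fun_prop) 1 ?_
    filter_upwards [hM0] with ω hω
    rw [Real.norm_of_nonneg (Real.exp_pos _).le, Real.exp_le_one_iff, neg_nonpos]
    exact Finset.sum_nonneg fun k _ => mul_nonneg (hs k).le (hω k)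
  -- The fibres of `Zhat` partition `Ω`, so the partial transforms add up to the full one.
  rw [← integral_iUnion_fintype (fun d => hZ (measurableSet_singleton d))
    (fun a b hab => (Set.disjoint_singleton.2 hab).preimage Zhat) fun _ => hint.integrableOn,
    ← Set.preimage_iUnion, Set.iUnion_of_singleton, Set.preimage_univ, setIntegral_univ]
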